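/- Conventions. A set $S\subset\mathbb{C}$ is $2\pi i$-periodic if $S+2\pi i=S$. An unbounded Jordan domain is an unbounded simply connected domain $U\subset\mathbb{C}$ whose boundary in the Riemann sphere $\hat{\mathbb{C}}$ is a Jordan curve (it then passes through $\infty$). Let $\mathcal{T},H\subset\mathbb{C}$. A function $F:\mathcal{T}\to H$ belongs to the class $\mathcal{B}_{\log}$ if the following hold, where the connected components of $\mathcal{T}$ are called the tracts of $F$. (A) $H$ is a $2\pi i$-periodic unbounded Jordan domain containing a right half-plane. (B) $\mathcal{T}\neq\emptyset$ is $2\pi i$-periodic, and the real part is bounded from below, but unbounded from above, on $\mathcal{T}$. (C) Each tract $T$ is an unbounded Jordan domain that is disjoint from $T+2\pi i k$ for every $k\in\mathbb{Z}\setminus\{0\}$. (D) For each tract $T$, the restriction $F:T\to H$ is a conformal isomorphism. (E) For each tract $T$, the restriction $F|_T$ extends continuously to the closure of $T$ in $\hat{\mathbb{C}}$, as a map into $\hat{\mathbb{C}}$, with $F(\infty)=\infty$. (F) The tracts accumulate only at infinity: if $(z_n)_{n\in\mathbb{N}}$ is a sequence of points of $\mathcal{T}$, each belonging to a different tract, then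 $z_n\to\infty$. Such an $F$ is of disjoint type if $\overline{\mathcal{T}}\subset H$, where the closure is taken in $\mathbb{C}$. Put $\rho_{\mathbb{D}}(z)=2/(1-|z|^2)$ on the unit disc $\mathbb{D}$. For a simply connected proper subdomain $U$ of $\mathbb{C}$ let $\rho_U(z)=\rho_{\mathbb{D}}(\phi(z))\,|\phi'(z)|$, where $\phi:U\to\mathbb{D}$ is any conformal isomorphism (the value does not depend on $\phi$), and let $d_U(z_1,z_2)=\inf_\gamma\int_\gamma\rho_U(z)\,|dz|$, the infimum being over all piecewise smooth curves $\gamma$ in $U$ that join $z_1$ to $z_2$. The hyperbolic derivative of $F$ in $H$ is $$\|DF(z)\|_H=\frac{\rho_H(F(z))}{\rho_H(z)}\,|F'(z)|,\qquad z\in\mathcal{T}\cap H,$$ which is defined on all of $\mathcal{T}$ if $F$ is of disjoint type. Lemma. Suppose that $F:\mathcal{T}\to H$ is a function in the class $\mathcal{B}_{\log}$ of disjoint type. Then there is a constant $L>1$ such that $$\|DF(z)\|_H\geq L\qquad\text{for all } z\in\mathcal{T}.$$ Moreover, with the same $L$, if $z_1,z_2$ belong to the same tract of $F$, then $$d_H(F(z_1),F(z_2))\geq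 L\,d_H(z_1,z_2).$$ -/

import Mathlib

open Set Filter Topology

noncomputable section

/-- A subset of the Riemann sphere `OnePoint ℂ` is a Jordan curve if it is the image of the unit
circle under an injective continuous map. -/
def IsJordanCurve (J : Set (OnePoint ℂ)) : Prop :=
  ∃ γ : Circle → OnePoint ℂ, Continuous γ ∧ Function.Injective γ ∧ range γ = J

/-- An unbounded Jordan domain: an unbounded simply connected domain `U` in the plane whose
boundary, taken in the Riemann sphere, is a Jordan curve.  (As `U` is unbounded and contained
in `ℂ`, that curve passes through `∞`.) -/
structure IsUnboundedJordanDomain (U : Set ℂ) : Prop where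
  isOpen : IsOpen U
  isSimplyConnected : IsSimplyConnected U
  unbounded : ¬ Bornology.IsBounded U
  jordan : IsJordanCurve (frontier ((fun z : ℂ => (z : OnePoint ℂ)) '' U))

/-- A set is `2πi`-periodic if it is invariant under the translation by `2πi`. -/
def IsTwoPiIPeriodic (S : Set ℂ) : Prop :=
  ∀ z : ℂ, z + 2 * (Real.pi : ℂ) * Complex.I ∈ S ↔ z ∈ S

/-- `φ` is a conformal isomorphism from `U` onto `V`: holomorphic on `U` and a bijection from
`U` to `V`. -/
def IsConformalIso (φ : ℂ → ℂ) (U V : Set ℂ) : Prop :=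
  DifferentiableOn ℂ φ U ∧ BijOn φ U V

/-- The tracts are the connected components of the domain of definition `𝒯`. -/
def IsTract (𝒯 T : Set ℂ) : Prop :=
  ∃ z ∈ 𝒯, T = connectedComponentIn 𝒯 z

/-- The class `𝓑_log` of functions `F : 𝒯 → H`.  Only the values of `F` on `𝒯` matter. -/
structure IsClassBlog (F : ℂ → ℂ) (𝒯 H : Set ℂ) : Prop where
  H_jordan : IsUnboundedJordanDomain H
  H_periodic : IsTwoPiIPeriodic H
  H_halfPlane : ∃ R : ℝ, {z : ℂ | R < z.re} ⊆ H
  nonempty : 𝒯.Nonempty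
  periodic : IsTwoPiIPeriodic 𝒯
  re_bddBelow : BddBelow (Complex.re '' 𝒯)
  re_not_bddAbove : ¬ BddAbove (Complex.re '' 𝒯)
  tract_jordan : ∀ T, IsTract 𝒯 T → IsUnboundedJordanDomain T
  tract_disjoint : ∀ T, IsTract 𝒯 T → ∀ k : ℤ, k ≠ 0 →
    Disjoint T ((fun z : ℂ => z + 2 * (Real.pi : ℂ) * Complex.I * (k : ℂ)) '' T)
  tract_iso : ∀ T, IsTract 𝒯 T → IsConformalIso F T H
  /-- On each tract, `F` extends continuously to the closure of the tract in the Riemann sphere,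
  with `F(∞) = ∞`. -/
  tract_extends : ∀ T, IsTract 𝒯 T → ∃ G : OnePoint ℂ → OnePoint ℂ,
    ContinuousOn G (closure ((fun z : ℂ => (z : OnePoint ℂ)) '' T)) ∧
    (∀ z ∈ T, G (z : OnePoint ℂ) = (F z : OnePoint ℂ)) ∧
    G OnePoint.infty = OnePoint.infty
  /-- The tracts accumulate only at infinity. -/
  tracts_accumulate : ∀ z : ℕ → ℂ, (∀ n, z n ∈ 𝒯) →
    Function.Injective (fun n => connectedComponentIn 𝒯 (z n)) →
    Tendsto z atTop (cocompact ℂ)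

/-- `F : 𝒯 → H` is of disjoint type if the closure of `𝒯` in the plane is contained in `H`. -/
def IsDisjointType (𝒯 H : Set ℂ) : Prop :=
  closure 𝒯 ⊆ H

/-- The hyperbolic density of the unit disc. -/
def discDensity (z : ℂ) : ℝ :=
  2 / (1 - ‖z‖ ^ 2)

open Classical in
/-- The hyperbolic density `ρ_U(z) = ρ_𝔻(φ(z)) |φ'(z)|`, where `φ` is a conformal isomorphism
from `U` onto the unit disc.  One exists for every simply connected proper subdomain `U` of the
plane, and the density does not depend on which one is chosen.  (The value is `0` by convention if
there is none.) -/
def hypDensity (U : Set ℂ) (z : ℂ) : ℝ :=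
  if h : ∃ φ : ℂ → ℂ, IsConformalIso φ U (Metric.ball 0 1) then
    discDensity (h.choose z) * ‖deriv h.choose z‖
  else 0

/-- The curve `γ : [0,1] → ℂ` is piecewise smooth: it is continuous, and `[0,1]` has a finite
subdivision `0 = t₀ ≤ t₁ ≤ … ≤ tₙ = 1` such that `γ` is continuously differentiable on each
`[tᵢ, tᵢ₊₁]`. -/
def IsPiecewiseSmooth (γ : ℝ → ℂ) : Prop :=
  ContinuousOn γ (Icc 0 1) ∧
  ∃ (n : ℕ) (t : ℕ → ℝ), t 0 = 0 ∧ t n = 1 ∧ Monotone t ∧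
    ∀ i < n, ContDiffOn ℝ 1 γ (Icc (t i) (t (i + 1)))

/-- The hyperbolic length `∫_γ ρ_U(z) |dz|` of a piecewise smooth curve in `U`. -/
def hypLength (U : Set ℂ) (γ : ℝ → ℂ) : ℝ :=
  ∫ t in (0 : ℝ)..1, hypDensity U (γ t) * ‖deriv γ t‖

/-- The hyperbolic distance in `U`: the infimum of the hyperbolic lengths of the piecewise smooth
curves in `U` that join `z₁` to `z₂`. -/
def hypDist (U : Set ℂ) (z₁ z₂ : ℂ) : ℝ :=
  sInf {ℓ : ℝ | ∃ γ : ℝ → ℂ, IsPiecewiseSmooth γ ∧ MapsTo γ (Icc 0 1) U ∧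
    γ 0 = z₁ ∧ γ 1 = z₂ ∧ ℓ = hypLength U γ}

/-- The hyperbolic derivative `‖DF(z)‖_W = ρ_W(F(z)) / ρ_W(z) · |F'(z)|`. -/
def hypDeriv (W : Set ℂ) (F : ℂ → ℂ) (z : ℂ) : ℝ :=
  hypDensity W (F z) / hypDensity W z * ‖deriv F z‖

end

/-! Let `φ : H → 𝔻` be a Riemann map, `z` a point of a tract `T`, and `s` the pseudo-hyperbolic
distance in `H` from `z` to `z + 2πi`. The latter point lies in `H` but not in `T`, so `φ` omits the
value `φ (z + 2πi)` on `T`. Move that value to `0` by a Möbius map and take a square root on the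
simply connected `T`: this is a holomorphic map `T → 𝔻` whose hyperbolic derivative at `z` exceeds
that of `φ` by the factor `(1 + s) / (2√s) > 1` (`exists_sq_eq_moebius_comp`). By Schwarz–Pick the
conformal isomorphism `φ ∘ F : T → 𝔻` has at least this derivative, so `‖DF(z)‖_H` is at least that
factor.

The factor decreases in `s`, so a uniform `L` needs `s` bounded away from `1` on `𝒯`
(`exists_norm_moebius_translate_le`). Far to the right this comes from a large disc inside the
half-plane in `H`; elsewhere from compactness modulo `2πi`, where disjoint type keeps the closure of
`𝒯` inside `H`. The distance estimate follows by pulling curves back under `F|_T` and comparing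
lengths.

The Riemann map itself comes from the extremal problem for embeddings in the disc, with the same
square-root trick giving surjectivity. -/

/-! ### Möbius maps and the Schwarz–Pick lemma on discs -/

/-- The Möbius transformation of the unit disc that sends `a` to `0`. -/
noncomputable def moebius (a w : ℂ) : ℂ :=
  (w - a) / (1 - starRingEnd ℂ a * w)

/-- The derivative of `f` at `z`, measured with the hyperbolic metric of the disc in the range. -/
noncomputable def diskDeriv (f : ℂ → ℂ) (z : ℂ) : ℝ :=
  ‖deriv f z‖ / (1 - ‖f z‖ ^ 2)

theorem one_sub_conj_mul_ne_zero {a w : ℂ} (ha : ‖a‖ < 1) (hw : ‖w‖ < 1) :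
    1 - starRingEnd ℂ a * w ≠ 0 := by
  intro h
  have h1 : ‖starRingEnd ℂ a * w‖ = 1 := by
    rw [← sub_eq_zero.1 h, norm_one]
  rw [norm_mul, RCLike.norm_conj] at h1
  nlinarith [norm_nonneg a, norm_nonneg w]

theorem one_sub_normSq_pos {w : ℂ} (hw : ‖w‖ < 1) : 0 < 1 - ‖w‖ ^ 2 := by
  nlinarith [norm_nonneg w]

theorem one_sub_normSq_moebius {a w : ℂ} (ha : ‖a‖ < 1) (hw : ‖w‖ < 1) :
    1 - ‖moebius a w‖ ^ 2 =
      (1 - ‖a‖ ^ 2) * (1 - ‖w‖ ^ 2) / ‖1 - starRingEnd ℂ a * w‖ ^ 2 := by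
  have h := norm_ne_zero_iff.2 (one_sub_conj_mul_ne_zero ha hw)
  rw [moebius, norm_div, div_pow, eq_div_iff (pow_ne_zero 2 h), sub_mul,
    div_mul_cancel₀ _ (pow_ne_zero 2 h)]
  simp only [Complex.sq_norm, Complex.normSq_apply, Complex.sub_re, Complex.sub_im, Complex.one_re,
    Complex.one_im, Complex.mul_re, Complex.mul_im, Complex.conj_re, Complex.conj_im]
  ring

theorem norm_moebius_lt_one {a w : ℂ} (ha : ‖a‖ < 1) (hw : ‖w‖ < 1) : ‖moebius a w‖ < 1 := by
  have h : 0 < 1 - ‖moebius a w‖ ^ 2 := by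
    rw [one_sub_normSq_moebius ha hw]
    have := norm_pos_iff.2 (one_sub_conj_mul_ne_zero ha hw)
    have := one_sub_normSq_pos ha
    have := one_sub_normSq_pos hw
    positivity
  nlinarith [norm_nonneg (moebius a w)]

theorem moebius_self (a : ℂ) : moebius a a = 0 := by simp [moebius]

theorem moebius_neg_zero (a : ℂ) : moebius (-a) 0 = a := by simp [moebius]

theorem moebius_eq_zero_iff {a w : ℂ} (ha : ‖a‖ < 1) (hw : ‖w‖ < 1) :
    moebius a w = 0 ↔ w = a := by
  rw [moebius, div_eq_zero_iff, or_iff_left (one_sub_conj_mul_ne_zero ha hw), sub_eq_zero]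

theorem moebius_neg_moebius {a w : ℂ} (ha : ‖a‖ < 1) (hw : ‖w‖ < 1) :
    moebius (-a) (moebius a w) = w := by
  have h1 := one_sub_conj_mul_ne_zero ha hw
  have h2 := one_sub_conj_mul_ne_zero (a := -a) (by simpa using ha) (norm_moebius_lt_one ha hw)
  rw [moebius, div_eq_iff h2, moebius]
  simp only [map_neg]
  rw [mul_comm] at h1
  field_simp
  ring

theorem hasDerivAt_moebius {a w : ℂ} (ha : ‖a‖ < 1) (hw : ‖w‖ < 1) :
    HasDerivAt (moebius a) ((1 - starRingEnd ℂ a * a) / (1 - starRingEnd ℂ a * w) ^ 2) w := by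
  have h := one_sub_conj_mul_ne_zero ha hw
  have h1 : HasDerivAt (fun w => w - a) 1 w := (hasDerivAt_id w).sub_const a
  have h2 : HasDerivAt (fun w => 1 - starRingEnd ℂ a * w) (-(starRingEnd ℂ a * 1)) w :=
    ((hasDerivAt_id w).const_mul _).const_sub 1
  refine (h1.div h2 h).congr_deriv ?_
  congr 1
  ring

theorem norm_one_sub_conj_mul_self {a : ℂ} (ha : ‖a‖ < 1) :
    ‖1 - starRingEnd ℂ a * a‖ = 1 - ‖a‖ ^ 2 := by
  rw [← Complex.normSq_eq_conj_mul_self, ← Complex.sq_norm, ← Complex.ofReal_one,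
    ← Complex.ofReal_sub, Complex.norm_real, Real.norm_of_nonneg (one_sub_normSq_pos ha).le]

/-- Möbius maps are isometries of the hyperbolic disc. This allows normalising a value of `f` to
`0`, where the Schwarz lemma applies. -/
theorem diskDeriv_moebius_comp {a z : ℂ} {f : ℂ → ℂ} (ha : ‖a‖ < 1) (hf : DifferentiableAt ℂ f z)
    (hz : ‖f z‖ < 1) : diskDeriv (fun w => moebius a (f w)) z = diskDeriv f z := by
  have h := norm_ne_zero_iff.2 (one_sub_conj_mul_ne_zero ha hz)
  have h1 := (one_sub_normSq_pos ha).ne'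
  have h2 := (one_sub_normSq_pos hz).ne'
  have hd : deriv (fun w => moebius a (f w)) z = _ :=
    ((hasDerivAt_moebius ha hz).comp z hf.hasDerivAt).deriv
  rw [diskDeriv, diskDeriv, hd, norm_mul, norm_div, norm_pow, norm_one_sub_conj_mul_self ha,
    one_sub_normSq_moebius ha hz]
  field_simp

theorem DifferentiableOn.moebius_comp {a : ℂ} {f : ℂ → ℂ} {U : Set ℂ} (ha : ‖a‖ < 1)
    (hf : DifferentiableOn ℂ f U) (hU : MapsTo f U (Metric.ball 0 1)) :
    DifferentiableOn ℂ (fun w => moebius a (f w)) U := fun z hz =>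
  (hasDerivAt_moebius ha (mem_ball_zero_iff.1 (hU hz))).differentiableAt.comp_differentiableWithinAt
    z (hf z hz)

theorem mapsTo_moebius_comp {a : ℂ} {f : ℂ → ℂ} {U : Set ℂ} (ha : ‖a‖ < 1)
    (hU : MapsTo f U (Metric.ball 0 1)) :
    MapsTo (fun w => moebius a (f w)) U (Metric.ball 0 1) := fun _ hz =>
  mem_ball_zero_iff.2 (norm_moebius_lt_one ha (mem_ball_zero_iff.1 (hU hz)))

/-- The Schwarz–Pick lemma for maps from an arbitrary disc to the unit disc. -/
theorem norm_moebius_le_of_mapsTo_ball {f : ℂ → ℂ} {c z : ℂ} {r : ℝ}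
    (hf : DifferentiableOn ℂ f (Metric.ball c r))
    (hm : MapsTo f (Metric.ball c r) (Metric.ball 0 1)) (hz : z ∈ Metric.ball c r) :
    ‖moebius (f c) (f z)‖ ≤ dist z c / r := by
  have hr : 0 < r := Metric.nonempty_ball.1 ⟨z, hz⟩
  have hc := mem_ball_zero_iff.1 (hm (Metric.mem_ball_self hr))
  have := Complex.dist_le_div_mul_dist_of_mapsTo_ball (R₂ := 1) (hf.moebius_comp hc hm) ?_ hz
  · simpa [moebius_self, div_eq_inv_mul] using this
  · simpa [moebius_self] using (mapsTo_moebius_comp hc hm).mono_right Metric.ball_subset_closedBall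

theorem diskDeriv_le_of_mapsTo_ball {f : ℂ → ℂ} {c : ℂ} {r : ℝ} (hr : 0 < r)
    (hf : DifferentiableOn ℂ f (Metric.ball c r))
    (hm : MapsTo f (Metric.ball c r) (Metric.ball 0 1)) : diskDeriv f c ≤ 1 / r := by
  have hc := mem_ball_zero_iff.1 (hm (Metric.mem_ball_self hr))
  rw [← diskDeriv_moebius_comp hc (hf.differentiableAt (Metric.ball_mem_nhds c hr)) hc]
  have := Complex.norm_deriv_le_div_of_mapsTo_ball (R₂ := 1) (hf.moebius_comp hc hm) ?_ hr
  · simpa [moebius_self, diskDeriv] using this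
  · simpa [moebius_self] using (mapsTo_moebius_comp hc hm).mono_right Metric.ball_subset_closedBall

/-- The Schwarz–Pick lemma in the unit disc, for the pseudo-hyperbolic distance. -/
theorem norm_moebius_map_le {g : ℂ → ℂ} {z w : ℂ} (hg : DifferentiableOn ℂ g (Metric.ball 0 1))
    (hm : MapsTo g (Metric.ball 0 1) (Metric.ball 0 1)) (hz : ‖z‖ < 1) (hw : ‖w‖ < 1) :
    ‖moebius (g z) (g w)‖ ≤ ‖moebius z w‖ := by
  have hz' : ‖-z‖ < 1 := by simpa using hz
  have h1 : DifferentiableOn ℂ (moebius (-z)) (Metric.ball 0 1) :=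
    differentiableOn_id.moebius_comp hz' (mapsTo_id _)
  have h2 : MapsTo (moebius (-z)) (Metric.ball 0 1) (Metric.ball 0 1) :=
    mapsTo_moebius_comp hz' (mapsTo_id _)
  have := norm_moebius_le_of_mapsTo_ball (hg.comp h1 h2) (hm.comp h2)
    (mem_ball_zero_iff.2 (norm_moebius_lt_one hz hw))
  simpa [moebius_neg_zero, moebius_neg_moebius hz hw] using this

/-- The Schwarz–Pick lemma in the unit disc, infinitesimal version. -/
theorem diskDeriv_le {g : ℂ → ℂ} {z : ℂ} (hg : DifferentiableOn ℂ g (Metric.ball 0 1))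
    (hm : MapsTo g (Metric.ball 0 1) (Metric.ball 0 1)) (hz : ‖z‖ < 1) :
    diskDeriv g z ≤ 1 / (1 - ‖z‖ ^ 2) := by
  have hz' : ‖-z‖ < 1 := by simpa using hz
  have h1 : DifferentiableOn ℂ (moebius (-z)) (Metric.ball 0 1) :=
    differentiableOn_id.moebius_comp hz' (mapsTo_id _)
  have h2 : MapsTo (moebius (-z)) (Metric.ball 0 1) (Metric.ball 0 1) :=
    mapsTo_moebius_comp hz' (mapsTo_id _)
  have h := diskDeriv_le_of_mapsTo_ball one_pos (hg.comp h1 h2) (hm.comp h2)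
  have hgz : HasDerivAt g (deriv g z) (moebius (-z) 0) := by
    rw [moebius_neg_zero]
    exact (hg.differentiableAt (Metric.isOpen_ball.mem_nhds (mem_ball_zero_iff.2 hz))).hasDerivAt
  have hd : deriv (g ∘ moebius (-z)) 0 = _ :=
    (hgz.comp 0 (hasDerivAt_moebius hz' (by simp))).deriv
  have hn := norm_one_sub_conj_mul_self hz'
  rw [diskDeriv, hd] at h
  simp only [Function.comp_apply, moebius_neg_zero, mul_zero, sub_zero, one_pow, div_one, norm_mul,
    hn, norm_neg] at h
  rw [diskDeriv, le_div_iff₀ (one_sub_normSq_pos hz), div_mul_eq_mul_div]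
  exact h

/-! ### Conformal isomorphisms and their inverses -/

theorem AnalyticAt.nhds_le_map_nhds_of_injOn {f : ℂ → ℂ} {U : Set ℂ} {z : ℂ}
    (hf : AnalyticAt ℂ f z) (hU : U ∈ 𝓝 z) (hinj : InjOn f U) : 𝓝 (f z) ≤ map f (𝓝 z) := by
  refine hf.eventually_constant_or_nhds_le_map_nhds.resolve_left fun h => ?_
  have h1 : ∀ᶠ w in 𝓝 z, w = z := by
    filter_upwards [h, hU] with w hw hwU using hinj hwU (mem_of_mem_nhds hU) hw
  have h2 : ∀ᶠ w in 𝓝[≠] z, w = z := h1.filter_mono nhdsWithin_le_nhds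
  obtain ⟨w, hw, hw'⟩ := (h2.and self_mem_nhdsWithin).exists
  exact hw' hw

/-- A conformal isomorphism has nonvanishing derivative, and its inverse is holomorphic. -/
theorem IsConformalIso.hasDerivAt_leftInverse {φ ψ : ℂ → ℂ} {U V : Set ℂ} (hU : IsOpen U)
    (hφ : IsConformalIso φ U V) (hψ : LeftInvOn ψ φ U) {z : ℂ} (hz : z ∈ U) :
    deriv φ z ≠ 0 ∧ HasDerivAt ψ (deriv φ z)⁻¹ (φ z) := by
  have hinj := hφ.2.injOn
  have han : ∀ {w}, w ∈ U → AnalyticAt ℂ φ w := fun hw => hφ.1.analyticAt (hU.mem_nhds hw)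
  have hmap : ∀ {w}, w ∈ U → 𝓝 (φ w) ≤ map φ (𝓝 w) := fun hw =>
    (han hw).nhds_le_map_nhds_of_injOn (hU.mem_nhds hw) hinj
  have himg : ∀ {w N}, w ∈ U → N ∈ 𝓝 w → φ '' (N ∩ U) ∈ 𝓝 (φ w) := fun hw hN =>
    hmap hw (image_mem_map (inter_mem hN (hU.mem_nhds hw)))
  have hcont : ∀ {w}, w ∈ U → ContinuousAt ψ (φ w) := by
    intro w hw N hN
    rw [hψ hw] at hN
    refine mem_map.2 (mem_of_superset (himg hw hN) ?_)
    rintro _ ⟨x, hx, rfl⟩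
    rw [mem_preimage, hψ hx.2]
    exact hx.1
  have hright : ∀ {w}, w ∈ U → ∀ᶠ y in 𝓝 (φ w), φ (ψ y) = y := by
    intro w hw
    refine mem_of_superset (himg hw univ_mem) ?_
    rintro _ ⟨x, hx, rfl⟩
    change φ (ψ (φ x)) = φ x
    rw [hψ hx.2]
  have hloc : ∀ {w}, w ∈ U → deriv φ w ≠ 0 → HasDerivAt ψ (deriv φ w)⁻¹ (φ w) := by
    intro w hw hd
    refine HasDerivAt.of_local_left_inverse (hcont hw) ?_ hd (hright hw)
    rw [hψ hw]
    exact (han hw).differentiableAt.hasDerivAt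
  -- Zeros of `deriv φ` are isolated, so `ψ` is holomorphic on a punctured neighbourhood of `φ z`.
  -- Being continuous there, it extends holomorphically across `φ z`, and the chain rule for `ψ ∘ φ
  -- = id` then forbids a zero at `z`.
  suffices h0 : deriv φ z ≠ 0 from ⟨h0, hloc hz h0⟩
  have hev : ∀ᶠ w in 𝓝[≠] z, deriv φ w ≠ 0 := by
    refine (han hz).deriv.eventually_eq_zero_or_eventually_ne_zero.resolve_left fun h => ?_
    obtain ⟨r, hr, hball⟩ := Metric.eventually_nhds_iff_ball.1 (h.and (hU.mem_nhds hz))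
    have hzr : z + (r / 2 : ℝ) ∈ Metric.ball z r := by
      simp [abs_of_pos hr]; linarith
    have hconst := (convex_ball z r).is_const_of_fderivWithin_eq_zero (𝕜 := ℂ) (f := φ)
      (hφ.1.mono fun w hw => (hball w hw).2) (fun w hw => by
        rw [fderivWithin_of_isOpen Metric.isOpen_ball hw]
        ext
        simpa using (hball w hw).1) hzr (Metric.mem_ball_self hr)
    have := hinj (hball _ hzr).2 hz hconst
    simp at this
    exact hr.ne' this
  have hψd : DifferentiableAt ℂ ψ (φ z) := by
    refine (Complex.analyticAt_of_differentiable_on_punctured_nhds_of_continuousAt ?_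
      (hcont hz)).differentiableAt
    have h1 : Tendsto ψ (𝓝[≠] (φ z)) (𝓝[≠] z) := by
      refine tendsto_nhdsWithin_iff.2 ⟨?_, ?_⟩
      · have := hcont hz
        rw [ContinuousAt, hψ hz] at this
        exact this.mono_left nhdsWithin_le_nhds
      · filter_upwards [(hright hz).filter_mono nhdsWithin_le_nhds, self_mem_nhdsWithin]
          with y hy hne h
        rw [mem_singleton_iff] at h
        rw [h] at hy
        exact hne hy.symm
    filter_upwards [h1.eventually hev, nhdsWithin_le_nhds (himg hz univ_mem)] with y hy hyU
    obtain ⟨x, hx, rfl⟩ := hyU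
    rw [hψ hx.2] at hy
    exact (hloc hx.2 hy).differentiableAt
  intro h0
  have hcomp : HasDerivAt (ψ ∘ φ) (deriv ψ (φ z) * deriv φ z) z :=
    hψd.hasDerivAt.comp z (han hz).differentiableAt.hasDerivAt
  have hid : HasDerivAt (ψ ∘ φ) 1 z :=
    (hasDerivAt_id z).congr_of_eventuallyEq (by
      filter_upwards [hU.mem_nhds hz] with w hw using hψ hw)
  have := hcomp.unique hid
  simp [h0] at this

theorem IsConformalIso.deriv_ne_zero {φ : ℂ → ℂ} {U V : Set ℂ} (hU : IsOpen U)
    (hφ : IsConformalIso φ U V) {z : ℂ} (hz : z ∈ U) : deriv φ z ≠ 0 :=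
  (hφ.hasDerivAt_leftInverse hU hφ.2.injOn.leftInvOn_invFunOn hz).1

/-- The inverse of a conformal isomorphism is a conformal isomorphism. -/
theorem IsConformalIso.exists_inverse {φ : ℂ → ℂ} {U V : Set ℂ} (hU : IsOpen U)
    (hφ : IsConformalIso φ U V) :
    ∃ ψ : ℂ → ℂ, IsConformalIso ψ V U ∧ LeftInvOn ψ φ U ∧ RightInvOn ψ φ V := by
  have hinv := hφ.2.invOn_invFunOn
  refine ⟨Function.invFunOn φ U, ⟨fun w hw => ?_, hφ.2.symm hinv.symm⟩, hinv.1, hinv.2⟩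
  obtain ⟨z, hz, rfl⟩ := hφ.2.surjOn hw
  exact (hφ.hasDerivAt_leftInverse hU hinv.1 hz).2.differentiableAt.differentiableWithinAt

theorem IsConformalIso.comp {φ χ : ℂ → ℂ} {U V W : Set ℂ} (hχ : IsConformalIso χ V W)
    (hφ : IsConformalIso φ U V) : IsConformalIso (χ ∘ φ) U W :=
  ⟨hχ.1.comp hφ.1 hφ.2.mapsTo, hχ.2.comp hφ.2⟩

/-- The Schwarz–Pick lemma: no holomorphic map to the disc expands the pseudo-hyperbolic distance
more than a conformal isomorphism. -/
theorem IsConformalIso.norm_moebius_le {φ g : ℂ → ℂ} {U : Set ℂ} (hU : IsOpen U)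
    (hφ : IsConformalIso φ U (Metric.ball 0 1)) (hg : DifferentiableOn ℂ g U)
    (hm : MapsTo g U (Metric.ball 0 1)) {z w : ℂ} (hz : z ∈ U) (hw : w ∈ U) :
    ‖moebius (g z) (g w)‖ ≤ ‖moebius (φ z) (φ w)‖ := by
  obtain ⟨ψ, hψ, hl, -⟩ := hφ.exists_inverse hU
  have := norm_moebius_map_le (hg.comp hψ.1 hψ.2.mapsTo) (hm.comp hψ.2.mapsTo)
    (mem_ball_zero_iff.1 (hφ.2.mapsTo hz)) (mem_ball_zero_iff.1 (hφ.2.mapsTo hw))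
  simpa [hl hz, hl hw] using this

/-- The Schwarz–Pick lemma, infinitesimal version: among the holomorphic maps to the disc, the
conformal isomorphisms have the largest derivative. -/
theorem IsConformalIso.diskDeriv_le {φ g : ℂ → ℂ} {U : Set ℂ} (hU : IsOpen U)
    (hφ : IsConformalIso φ U (Metric.ball 0 1)) (hg : DifferentiableOn ℂ g U)
    (hm : MapsTo g U (Metric.ball 0 1)) {z : ℂ} (hz : z ∈ U) :
    diskDeriv g z ≤ diskDeriv φ z := by
  obtain ⟨ψ, hψ, hl, -⟩ := hφ.exists_inverse hU
  have h := _root_.diskDeriv_le (hg.comp hψ.1 hψ.2.mapsTo) (hm.comp hψ.2.mapsTo)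
    (mem_ball_zero_iff.1 (hφ.2.mapsTo hz))
  obtain ⟨h0, hd⟩ := hφ.hasDerivAt_leftInverse hU hl hz
  have hgz : HasDerivAt g (deriv g z) (ψ (φ z)) := by
    rw [hl hz]
    exact (hg.differentiableAt (hU.mem_nhds hz)).hasDerivAt
  rw [diskDeriv, (hgz.comp (φ z) hd).deriv, Function.comp_apply, hl hz, norm_mul, norm_inv] at h
  have := norm_pos_iff.2 h0
  rw [diskDeriv, diskDeriv]
  calc _ = ‖deriv g z‖ * ‖deriv φ z‖⁻¹ / (1 - ‖g z‖ ^ 2) * ‖deriv φ z‖ := by field_simp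
    _ ≤ 1 / (1 - ‖φ z‖ ^ 2) * ‖deriv φ z‖ := by gcongr
    _ = _ := by ring

/-! ### The square-root trick -/

/-- The slope of `g` is the slope of `h` times `h w + h z`, so continuity of the root suffices for
its differentiability. -/
theorem hasDerivAt_of_sq_eq {g h : ℂ → ℂ} {g' z : ℂ} (hg : HasDerivAt g g' z)
    (hc : ContinuousAt h z) (hz : h z ≠ 0) (hsq : ∀ᶠ w in 𝓝 z, h w ^ 2 = g w) :
    HasDerivAt h (g' / (2 * h z)) z := by
  rw [hasDerivAt_iff_tendsto_slope] at hg ⊢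
  have h2 : h z + h z ≠ 0 := by rw [← two_mul]; exact mul_ne_zero two_ne_zero hz
  have hc' : ContinuousAt (fun w => h w + h z) z := hc.add continuousAt_const
  have h1 := hg.div (hc'.tendsto.mono_left nhdsWithin_le_nhds) h2
  rw [← two_mul] at h1
  refine h1.congr' ?_
  filter_upwards [hsq.filter_mono nhdsWithin_le_nhds,
    (hc'.eventually_ne h2).filter_mono nhdsWithin_le_nhds] with w hw hne
  rw [Pi.div_apply, slope_def_field, slope_def_field, ← hw, ← hsq.self_of_nhds, div_div,
    mul_comm, ← div_div]
  congr 1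
  rw [div_eq_iff hne]
  ring

/-- A holomorphic map from a simply connected domain to the disc that omits a value can be
replaced by one with a larger derivative. -/
theorem exists_sq_eq_moebius_comp {f : ℂ → ℂ} {U : Set ℂ} (hU : IsOpen U)
    (hUc : IsSimplyConnected U) (hf : DifferentiableOn ℂ f U)
    (hm : MapsTo f U (Metric.ball 0 1)) {a : ℂ} (ha : ‖a‖ < 1) (hfa : ∀ z ∈ U, f z ≠ a) :
    ∃ h : ℂ → ℂ, DifferentiableOn ℂ h U ∧ MapsTo h U (Metric.ball 0 1) ∧
      (∀ z, h z ^ 2 = moebius a (f z)) ∧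
      ∀ z ∈ U, diskDeriv h z = diskDeriv f z *
        ((1 + ‖moebius a (f z)‖) / (2 * √‖moebius a (f z)‖)) := by
  have hg := hf.moebius_comp ha hm
  have hgm := mapsTo_moebius_comp ha hm
  have hne : ∀ z ∈ U, moebius a (f z) ≠ 0 := fun z hz => by
    rw [Ne, moebius_eq_zero_iff ha (mem_ball_zero_iff.1 (hm hz))]
    exact hfa z hz
  obtain ⟨h, hc, hsq⟩ := Complex.exists_continuousOn_pow_eq hUc hU hg.continuousOn
    (by rintro ⟨z, hz, h0⟩; exact hne z hz h0) two_ne_zero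
  have hh : ∀ z ∈ U, h z ≠ 0 := fun z hz h0 => hne z hz (by rw [← hsq, h0]; simp)
  have hd : ∀ z ∈ U, HasDerivAt h (deriv (fun w => moebius a (f w)) z / (2 * h z)) z :=
    fun z hz => hasDerivAt_of_sq_eq (hg.differentiableAt (hU.mem_nhds hz)).hasDerivAt
      (hc.continuousAt (hU.mem_nhds hz)) (hh z hz) (Eventually.of_forall hsq)
  have hlt : ∀ z ∈ U, ‖h z‖ < 1 := fun z hz => by
    have : ‖moebius a (f z)‖ < 1 := mem_ball_zero_iff.1 (hgm hz)
    rw [← hsq, norm_pow] at this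
    exact (pow_lt_one_iff_of_nonneg (norm_nonneg _) two_ne_zero).1 this
  refine ⟨h, fun z hz => (hd z hz).differentiableAt.differentiableWithinAt,
    fun z hz => mem_ball_zero_iff.2 (hlt z hz), hsq, fun z hz => ?_⟩
  rw [← diskDeriv_moebius_comp ha (hf.differentiableAt (hU.mem_nhds hz))
    (mem_ball_zero_iff.1 (hm hz)), diskDeriv, diskDeriv, (hd z hz).deriv, ← hsq, norm_pow,
    Real.sqrt_sq (norm_nonneg _), norm_div, norm_mul, Complex.norm_ofNat]
  have h1 := norm_ne_zero_iff.2 (hh z hz)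
  have h2 := (one_sub_normSq_pos (hlt z hz)).ne'
  have h3 : 1 + ‖h z‖ ^ 2 ≠ 0 := by positivity
  have h4 : 1 - (‖h z‖ ^ 2) ^ 2 = (1 - ‖h z‖ ^ 2) * (1 + ‖h z‖ ^ 2) := by ring
  rw [h4]
  field_simp

/-- With `x = √s` the gain is `(x + 1/x) / 2`, which exceeds `1` and decreases on `(0, 1)`. -/
theorem one_lt_one_add_div_two_mul_sqrt {s : ℝ} (h0 : 0 < s) (h1 : s < 1) :
    1 < (1 + s) / (2 * √s) := by
  have hs := Real.sqrt_pos.2 h0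
  have hs1 : √s < 1 := by rwa [Real.sqrt_lt' one_pos, one_pow]
  rw [one_lt_div (by positivity)]
  nlinarith [Real.sq_sqrt h0.le]

theorem one_add_div_two_mul_sqrt_le {s t : ℝ} (h0 : 0 < s) (hst : s ≤ t) (h1 : t ≤ 1) :
    (1 + t) / (2 * √t) ≤ (1 + s) / (2 * √s) := by
  have hs := Real.sqrt_pos.2 h0
  have hst' := Real.sqrt_le_sqrt hst
  have ht1 : √t ≤ 1 := by rwa [Real.sqrt_le_one]
  have ht := hs.trans_le hst'
  rw [div_le_div_iff₀ (by positivity) (by positivity)]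
  have e1 := Real.sq_sqrt h0.le
  have e2 := Real.sq_sqrt (h0.le.trans hst)
  set x := √s
  set y := √t
  rw [← e1, ← e2]
  nlinarith [mul_nonneg (sub_nonneg.2 hst') (sub_nonneg.2 (mul_le_one₀ (hst'.trans ht1) ht.le ht1))]

/-! ### Montel's and Hurwitz's theorems -/

/-- A uniformly bounded family of holomorphic functions is equicontinuous on every subset of its
domain. -/
theorem equicontinuousOn_of_mapsTo_ball {ι : Type*} {F : ι → ℂ → ℂ} {U K : Set ℂ} (hU : IsOpen U)
    (hF : ∀ i, DifferentiableOn ℂ (F i) U) (hm : ∀ i, MapsTo (F i) U (Metric.ball 0 1))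
    (hK : K ⊆ U) : EquicontinuousOn F K := by
  intro c hc
  obtain ⟨r, hr, hball⟩ := Metric.isOpen_iff.1 hU c (hK hc)
  refine EquicontinuousAt.equicontinuousWithinAt ?_ K
  -- Two values in the unit disc are less than `2` apart, so the Schwarz lemma on `ball c r` gives
  -- the slope `2 / r`.
  refine Metric.equicontinuousAt_of_continuity_modulus (fun z => 2 / r * dist z c) ?_ F ?_
  · have : Continuous fun z => 2 / r * dist z c := by fun_prop
    simpa using this.tendsto c
  · filter_upwards [Metric.ball_mem_nhds c hr] with z hz i
    rw [dist_comm]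
    refine Complex.dist_le_div_mul_dist_of_mapsTo_ball ((hF i).mono hball) (fun w hw => ?_) hz
    have h1 := mem_ball_zero_iff.1 (hm i (hball hw))
    have h2 := mem_ball_zero_iff.1 (hm i (hK hc))
    rw [Metric.mem_closedBall, dist_eq_norm]
    linarith [norm_sub_le (F i w) (F i c)]

/-- Montel's theorem for maps to the unit disc, along an ultrafilter. -/
theorem exists_tendstoLocallyUniformlyOn_of_mapsTo_ball {ι : Type*} (l : Ultrafilter ι)
    {F : ι → ℂ → ℂ} {U : Set ℂ} (hU : IsOpen U) (hF : ∀ i, DifferentiableOn ℂ (F i) U)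
    (hm : ∀ i, MapsTo (F i) U (Metric.ball 0 1)) :
    ∃ f : ℂ → ℂ, TendstoLocallyUniformlyOn F f l U := by
  have hlim : ∀ z ∈ U, ∃ w, Tendsto (fun i => F i z) l (𝓝 w) := by
    intro z hz
    obtain ⟨w, -, hw⟩ := (isCompact_closedBall (0 : ℂ) 1).ultrafilter_le_nhds
      (l.map fun i => F i z) (by
        rw [le_principal_iff]
        exact Eventually.of_forall (f := (l : Filter ι))
          fun i => Metric.ball_subset_closedBall (hm i hz))
    exact ⟨w, hw⟩
  choose! f hf using hlim
  refine ⟨f, (tendstoLocallyUniformlyOn_iff_forall_isCompact hU).2 fun K hKU hK => ?_⟩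
  have h := (EquicontinuousOn.tendsto_uniformOnFun_iff_pi' (𝔖 := {K}) (F := F)
    (by rintro _ rfl; exact hK)
    (by rintro _ rfl; exact equicontinuousOn_of_mapsTo_ball hU hF hm hKU) l f).2 (by
      rw [tendsto_pi_nhds]
      rintro ⟨z, hz⟩
      exact hf z (hKU (by simpa using hz)))
  exact UniformOnFun.tendsto_iff_tendstoUniformlyOn.1 h K rfl

/-- Hurwitz's theorem: a locally uniform limit of injective holomorphic functions is injective if it
is nowhere locally constant. -/
theorem injOn_of_tendstoLocallyUniformlyOn {ι : Type*} {l : Filter ι} [l.NeBot] {F : ι → ℂ → ℂ}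
    {f : ℂ → ℂ} {U : Set ℂ} (hU : IsOpen U) (hF : ∀ i, DifferentiableOn ℂ (F i) U)
    (hinj : ∀ i, InjOn (F i) U) (hlim : TendstoLocallyUniformlyOn F f l U)
    (hne : ∀ z ∈ U, ∀ᶠ w in 𝓝[≠] z, f w ≠ f z) : InjOn f U := by
  intro a ha b hb hab
  by_contra hne'
  have hba : 0 < dist a b := dist_pos.2 hne'
  obtain ⟨r₁, hr₁, h₁⟩ := Metric.eventually_nhds_iff_ball.1
    ((eventually_nhdsWithin_iff.1 (hne b hb)).and (hU.mem_nhds hb))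
  -- The circle about `b` avoids the value `f b` and leaves `a` outside. For `F i` within `ε / 8` of
  -- `f`, the image of the closed disc covers `ball (F i b) (ε / 4)`, which contains `F i a`; this
  -- contradicts injectivity.
  obtain ⟨r, hr, hrr⟩ := exists_between (lt_min hr₁ hba)
  have hrU : Metric.closedBall b r ⊆ U := fun z hz =>
    (h₁ z (lt_of_le_of_lt hz (hrr.trans_le (min_le_left _ _)))).2
  have hsph : ∀ z ∈ Metric.sphere b r, f z ≠ f b := fun z hz =>
    (h₁ z (lt_of_le_of_lt (Metric.sphere_subset_closedBall hz)
      (hrr.trans_le (min_le_left _ _)))).1 (Metric.ne_of_mem_sphere hz hr.ne')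
  have hfc : ContinuousOn f U :=
    hlim.continuousOn (Frequently.of_forall fun i => (hF i).continuousOn)
  obtain ⟨x, hx, hmin⟩ := (isCompact_sphere b r).exists_isMinOn
    (NormedSpace.sphere_nonempty.2 hr.le) (f := fun z => ‖f z - f b‖)
    ((hfc.mono (Metric.sphere_subset_closedBall.trans hrU)).sub continuousOn_const).norm
  set ε := ‖f x - f b‖ with hε
  have hε0 : 0 < ε := norm_pos_iff.2 (sub_ne_zero.2 (hsph x hx))
  have hunif := Metric.tendstoUniformlyOn_iff.1
    ((tendstoLocallyUniformlyOn_iff_forall_isCompact hU).1 hlim _ hrU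
      (isCompact_closedBall b r)) (ε / 8) (by positivity)
  have hta := Metric.tendsto_nhds.1 (hlim.tendsto_at ha) (ε / 8) (by positivity)
  obtain ⟨i, hi, hia⟩ := (hunif.and hta).exists
  have hib : dist (f b) (F i b) < ε / 8 := hi b (Metric.mem_closedBall_self hr.le)
  have hdc : DiffContOnCl ℂ (F i) (Metric.ball b r) :=
    ((hF i).mono (closure_ball b hr.ne' ▸ hrU)).diffContOnCl
  have hsub := hdc.ball_subset_image_closedBall (ε := ε / 2) hr (fun z hz => by
      have h1 : ε ≤ ‖f z - f b‖ := hmin hz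
      have h2 := hi z (Metric.sphere_subset_closedBall hz)
      rw [dist_eq_norm] at h2 hib
      have h3 : f z - f b = (F i z - F i b) + (f z - F i z) - (f b - F i b) := by ring
      have h4 := norm_sub_le ((F i z - F i b) + (f z - F i z)) (f b - F i b)
      have h5 := norm_add_le (F i z - F i b) (f z - F i z)
      rw [← h3] at h4
      linarith) (by
    have : ∀ᶠ z in 𝓝[≠] b, F i z ≠ F i b := by
      filter_upwards [nhdsWithin_le_nhds (hU.mem_nhds hb), self_mem_nhdsWithin] with z hz hzb h
      exact hzb (hinj i hz hb h)
    exact this.frequently.filter_mono nhdsWithin_le_nhds)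
  have hmem : F i a ∈ Metric.ball (F i b) (ε / 2 / 2) := by
    rw [Metric.mem_ball]
    have := dist_triangle4 (F i a) (f a) (f b) (F i b)
    rw [hab, dist_self] at this
    rw [hab] at hia
    linarith
  obtain ⟨z, hz, hza⟩ := hsub hmem
  have hz' := hinj i (hrU hz) ha hza
  rw [hz'] at hz
  exact (lt_of_lt_of_le hrr (min_le_right _ _)).not_ge hz

/-! ### The Riemann mapping theorem -/

theorem diskDeriv_pos_of_injOn {f : ℂ → ℂ} {U : Set ℂ} (hU : IsOpen U)
    (hf : DifferentiableOn ℂ f U) (hm : MapsTo f U (Metric.ball 0 1)) (hinj : InjOn f U) {z : ℂ}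
    (hz : z ∈ U) : 0 < diskDeriv f z :=
  div_pos (norm_pos_iff.2 (IsConformalIso.deriv_ne_zero (V := f '' U) hU
    ⟨hf, hinj.bijOn_image⟩ hz)) (one_sub_normSq_pos (mem_ball_zero_iff.1 (hm hz)))

/-- The holomorphic embeddings of `U` in the unit disc. -/
def diskEmbeddings (U : Set ℂ) : Set (ℂ → ℂ) :=
  {f | DifferentiableOn ℂ f U ∧ MapsTo f U (Metric.ball 0 1) ∧ InjOn f U}

theorem moebius_comp_mem_diskEmbeddings {a : ℂ} {f : ℂ → ℂ} {U : Set ℂ} (ha : ‖a‖ < 1)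
    (hf : f ∈ diskEmbeddings U) : (fun w => moebius a (f w)) ∈ diskEmbeddings U := by
  refine ⟨hf.1.moebius_comp ha hf.2.1, mapsTo_moebius_comp ha hf.2.1, fun x hx y hy hxy => ?_⟩
  have h : moebius (-a) (moebius a (f x)) = moebius (-a) (moebius a (f y)) := congrArg _ hxy
  rw [moebius_neg_moebius ha (mem_ball_zero_iff.1 (hf.2.1 hx)),
    moebius_neg_moebius ha (mem_ball_zero_iff.1 (hf.2.1 hy))] at h
  exact hf.2.2 hx hy h

/-- Among the holomorphic embeddings of a domain in the disc, there is one with the largest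
derivative at a given point. -/
theorem exists_isMaxOn_diskDeriv {U : Set ℂ} (hU : IsOpen U) (hUc : IsPreconnected U)
    (hne : (diskEmbeddings U).Nonempty) {z : ℂ} (hz : z ∈ U) :
    ∃ f ∈ diskEmbeddings U, ∀ g ∈ diskEmbeddings U, diskDeriv g z ≤ diskDeriv f z := by
  set S := (fun f => diskDeriv f z) '' diskEmbeddings U with hS
  obtain ⟨r, hr, hball⟩ := Metric.isOpen_iff.1 hU z hz
  have hbdd : BddAbove S := by
    refine ⟨1 / r, ?_⟩
    rintro _ ⟨f, hf, rfl⟩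
    exact diskDeriv_le_of_mapsTo_ball hr (hf.1.mono hball) (hf.2.1.mono_left hball)
  obtain ⟨u, -, hu, huS⟩ := exists_seq_tendsto_sSup (hne.image _) hbdd
  choose G hGS hGu using huS
  have hGz : ∀ i, ‖G i z‖ < 1 := fun i => mem_ball_zero_iff.1 ((hGS i).2.1 hz)
  -- Normalised to vanish at `z`, the maps have `diskDeriv` equal to the modulus of the derivative,
  -- which passes to the limit.
  let F : ℕ → ℂ → ℂ := fun i w => moebius (G i z) (G i w)
  have hFS : ∀ i, F i ∈ diskEmbeddings U := fun i => moebius_comp_mem_diskEmbeddings (hGz i) (hGS i)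
  have hFz : ∀ i, F i z = 0 := fun i => moebius_self _
  have hFu : ∀ i, ‖deriv (F i) z‖ = u i := fun i => by
    have h := diskDeriv_moebius_comp (hGz i) ((hGS i).1.differentiableAt (hU.mem_nhds hz)) (hGz i)
    have h' : diskDeriv (F i) z = u i := h.trans (hGu i)
    rw [← h', diskDeriv, hFz]
    simp
  -- A nonprincipal ultrafilter replaces the extraction of a subsequence.
  let l : Ultrafilter ℕ := hyperfilter ℕ
  have hl : (l : Filter ℕ) ≤ atTop := by
    rw [← Nat.cofinite_eq_atTop]; exact hyperfilter_le_cofinite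
  obtain ⟨f, hf⟩ := exists_tendstoLocallyUniformlyOn_of_mapsTo_ball l hU (fun i => (hFS i).1)
    (fun i => (hFS i).2.1)
  have hev : ∀ᶠ i in (l : Filter ℕ), DifferentiableOn ℂ (F i) U :=
    Eventually.of_forall fun i => (hFS i).1
  have hd : DifferentiableOn ℂ f U := hf.differentiableOn hev hU
  have hpos : 0 < sSup S := by
    obtain ⟨g, hg⟩ := hne
    exact (diskDeriv_pos_of_injOn hU hg.1 hg.2.1 hg.2.2 hz).trans_le
      (le_csSup hbdd (mem_image_of_mem _ hg))
  have hder : ‖deriv f z‖ = sSup S :=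
    tendsto_nhds_unique ((hf.deriv hev hU).tendsto_at hz).norm
      ((hu.mono_left hl).congr fun i => (hFu i).symm)
  have hfz : f z = 0 :=
    tendsto_nhds_unique (hf.tendsto_at hz) (tendsto_const_nhds.congr fun i => (hFz i).symm)
  have han : AnalyticOnNhd ℂ f U := hd.analyticOnNhd hU
  have hnc : ¬ ∃ w, ∀ x ∈ U, f x = w := by
    rintro ⟨w, hw⟩
    have h0 : f =ᶠ[𝓝 z] fun _ => w := by
      filter_upwards [hU.mem_nhds hz] with x hx using hw x hx
    rw [h0.deriv_eq, deriv_const, norm_zero] at hder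
    exact hpos.ne hder
  have hopen := (han.is_constant_or_isOpen hUc).resolve_left hnc
  have hball' : MapsTo f U (Metric.ball 0 1) := by
    have h1 : f '' U ⊆ Metric.closedBall 0 1 := by
      rintro _ ⟨w, hw, rfl⟩
      exact mem_closedBall_zero_iff.2 (le_of_tendsto (hf.tendsto_at hw).norm
        (Eventually.of_forall fun i => (mem_ball_zero_iff.1 ((hFS i).2.1 hw)).le))
    have h2 := (hopen U subset_rfl hU).subset_interior_iff.2 h1
    rw [interior_closedBall _ one_ne_zero] at h2
    exact mapsTo_iff_image_subset.2 h2
  have hinj : InjOn f U := by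
    refine injOn_of_tendstoLocallyUniformlyOn (l := l) hU (fun i => (hFS i).1)
      (fun i => (hFS i).2.2) hf fun x hx => ?_
    refine ((han x hx).eventually_eq_or_eventually_ne analyticAt_const).resolve_left fun h => hnc ?_
    exact ⟨f x, han.eqOn_of_preconnected_of_eventuallyEq analyticOnNhd_const hUc hx h⟩
  refine ⟨f, ⟨hd, hball', hinj⟩, fun g hg => (le_csSup hbdd (mem_image_of_mem _ hg)).trans_eq ?_⟩
  rw [diskDeriv, hfz, hder]
  simp

/-- A simply connected proper subdomain of the plane embeds holomorphically in the unit disc. -/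
theorem nonempty_diskEmbeddings {U : Set ℂ} (hU : IsOpen U) (hUc : IsSimplyConnected U)
    (hne : U ≠ univ) : (diskEmbeddings U).Nonempty := by
  obtain ⟨a, ha⟩ := (ne_univ_iff_exists_notMem U).1 hne
  obtain ⟨z, hz⟩ := hUc.nonempty
  obtain ⟨h, hc, hsq⟩ := Complex.exists_continuousOn_pow_eq hUc hU
    (g := fun w => w - a) (by fun_prop)
    (by rintro ⟨w, hw, h0⟩; exact ha (sub_eq_zero.1 h0 ▸ hw)) two_ne_zero
  have hh : ∀ w ∈ U, h w ≠ 0 := fun w hw h0 => by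
    have := hsq w
    rw [h0, zero_pow two_ne_zero, eq_comm, sub_eq_zero] at this
    exact ha (this ▸ hw)
  have hinj : Function.Injective h := fun x y hxy => by
    have := hsq x
    rw [hxy, hsq y] at this
    exact (sub_left_injective this).symm
  have hd : DifferentiableOn ℂ h U := fun w hw =>
    (hasDerivAt_of_sq_eq ((hasDerivAt_id w).sub_const a) (hc.continuousAt (hU.mem_nhds hw))
      (hh w hw) (Eventually.of_forall hsq)).differentiableAt.differentiableWithinAt
  have himg : h '' U ∈ 𝓝 (h z) :=
    (hd.analyticAt (hU.mem_nhds hz)).nhds_le_map_nhds_of_injOn (hU.mem_nhds hz) hinj.injOn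
      (image_mem_map (hU.mem_nhds hz))
  obtain ⟨r, hr, hball⟩ := Metric.mem_nhds_iff.1 himg
  -- Since `h` is an injective root without zeros, it never takes both a value and its negative on
  -- `U`. As its image contains a ball about `h z`, it omits the opposite ball, and inversion about
  -- `-h z` makes it bounded.
  have hfar : ∀ w ∈ U, r ≤ ‖h w + h z‖ := fun w hw => by
    by_contra! hlt
    obtain ⟨x, hx, hxw⟩ := hball (show -h w ∈ Metric.ball (h z) r by
      rwa [Metric.mem_ball, dist_eq_norm, ← neg_add', norm_neg])
    have hxw' : x = w := by
      have := hsq x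
      rw [hxw, neg_sq, hsq w] at this
      exact (sub_left_injective this).symm
    rw [hxw', self_eq_neg] at hxw
    exact hh w hw hxw
  have hne0 : ∀ w ∈ U, h w + h z ≠ 0 := fun w hw h0 => by
    have := hfar w hw
    rw [h0, norm_zero] at this
    exact this.not_gt hr
  refine ⟨fun w => (r / 2 : ℝ) / (h w + h z), ?_, fun w hw => ?_, fun x hx y hy hxy => ?_⟩
  · exact (differentiableOn_const _).div (hd.add_const _) hne0
  · rw [mem_ball_zero_iff, norm_div, Complex.norm_real, Real.norm_of_nonneg (by positivity),
      div_lt_one (norm_pos_iff.2 (hne0 w hw))]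
    linarith [hfar w hw]
  · have hr' : ((r / 2 : ℝ) : ℂ) ≠ 0 := Complex.ofReal_ne_zero.2 (by positivity)
    simp only [div_eq_mul_inv] at hxy
    exact hinj (add_right_cancel (inv_injective (mul_left_cancel₀ hr' hxy)))

/-- The Riemann mapping theorem. -/
theorem exists_isConformalIso_ball {U : Set ℂ} (hU : IsOpen U) (hUc : IsSimplyConnected U)
    (hne : U ≠ univ) : ∃ φ : ℂ → ℂ, IsConformalIso φ U (Metric.ball 0 1) := by
  obtain ⟨z, hz⟩ := hUc.nonempty
  obtain ⟨f, ⟨hf, hm, hinj⟩, hmax⟩ := exists_isMaxOn_diskDeriv hU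
    hUc.isPathConnected.isConnected.isPreconnected (nonempty_diskEmbeddings hU hUc hne) hz
  refine ⟨f, hf, hm, hinj, fun a ha => ?_⟩
  by_contra hfa
  have ha' := mem_ball_zero_iff.1 ha
  have hfa' : ∀ w ∈ U, f w ≠ a := fun w hw h => hfa ⟨w, hw, h⟩
  -- An omitted value yields another embedding with a strictly larger derivative at `z`, against
  -- extremality.
  obtain ⟨h, hhd, hhm, hsq, hD⟩ := exists_sq_eq_moebius_comp hU hUc hf hm ha' hfa'
  have hhinj : InjOn h U := by
    intro x hx y hy hxy
    refine (moebius_comp_mem_diskEmbeddings ha' ⟨hf, hm, hinj⟩).2.2 hx hy ?_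
    change moebius a (f x) = moebius a (f y)
    rw [← hsq, ← hsq, hxy]
  have hle := hmax h ⟨hhd, hhm, hhinj⟩
  have hfz := mem_ball_zero_iff.1 (hm hz)
  rw [hD z hz] at hle
  have h1 := one_lt_one_add_div_two_mul_sqrt
    (norm_pos_iff.2 (mt (moebius_eq_zero_iff ha' hfz).1 (hfa' z hz))) (norm_moebius_lt_one ha' hfz)
  exact (lt_mul_of_one_lt_right (diskDeriv_pos_of_injOn hU hf hm hinj hz) h1).not_ge hle

/-! ### Uniform expansion of the hyperbolic metric -/

/-- The frontier of the plane in the sphere has no point other than `∞`, too small for a Jordan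
curve. -/
theorem IsUnboundedJordanDomain.ne_univ {U : Set ℂ} (hU : IsUnboundedJordanDomain U) :
    U ≠ univ := by
  rintro rfl
  obtain ⟨γ, -, hinj, hγ⟩ := hU.jordan
  have h : ∀ x, γ x = OnePoint.infty := by
    intro x
    have hx : γ x ∈ frontier ((fun z : ℂ => (z : OnePoint ℂ)) '' univ) := hγ ▸ mem_range_self x
    rw [image_univ, OnePoint.isOpen_range_coe.frontier_eq] at hx
    by_contra hne
    obtain ⟨z, hz⟩ := OnePoint.ne_infty_iff_exists.1 hne
    exact hx.2 ⟨z, hz⟩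
  have h1 : (1 : Circle) = -1 := hinj ((h 1).trans (h (-1)).symm)
  have h2 : (1 : ℂ) = -1 := by simpa using congrArg (fun z : Circle => (z : ℂ)) h1
  norm_num at h2

theorem IsTwoPiIPeriodic.add_mul_int_mem_iff {S : Set ℂ} (hS : IsTwoPiIPeriodic S) (z : ℂ)
    (k : ℤ) : z + k * (2 * (Real.pi : ℂ) * Complex.I) ∈ S ↔ z ∈ S := by
  have h : Function.Periodic (fun z => z ∈ S) (2 * (Real.pi : ℂ) * Complex.I) :=
    fun z => propext (hS z)
  exact iff_of_eq (h.int_mul k z)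

theorem ContinuousOn.moebius {f g : ℂ → ℂ} {U : Set ℂ} (hf : ContinuousOn f U)
    (hg : ContinuousOn g U) (hfm : MapsTo f U (Metric.ball 0 1))
    (hgm : MapsTo g U (Metric.ball 0 1)) : ContinuousOn (fun z => _root_.moebius (f z) (g z)) U :=
  (hg.sub hf).div (continuousOn_const.sub ((Complex.continuous_conj.comp_continuousOn hf).mul hg))
    fun _ hz => one_sub_conj_mul_ne_zero (mem_ball_zero_iff.1 (hfm hz))
      (mem_ball_zero_iff.1 (hgm hz))

/-- For a function of disjoint type, the hyperbolic distance in `H` between `z` and `z + 2πi` is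
bounded uniformly in `z ∈ 𝒯`. -/
theorem exists_norm_moebius_translate_le {F φ : ℂ → ℂ} {𝒯 H : Set ℂ} (hF : IsClassBlog F 𝒯 H)
    (hdisj : IsDisjointType 𝒯 H) (hφ : IsConformalIso φ H (Metric.ball 0 1)) :
    ∃ s < 1, ∀ z ∈ 𝒯, ‖moebius (φ z) (φ (z + 2 * (Real.pi : ℂ) * Complex.I))‖ ≤ s := by
  obtain ⟨R, hR⟩ := hF.H_halfPlane
  obtain ⟨m, hm⟩ := hF.re_bddBelow
  have hH := hF.H_jordan.isOpen
  set τ : ℂ := 2 * (Real.pi : ℂ) * Complex.I with hτ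
  have hτim : τ.im = 2 * Real.pi := by simp [hτ]
  have hτre : τ.re = 0 := by simp [hτ]
  have hHτ : ∀ z ∈ H, z + τ ∈ H := fun z hz => (hF.H_periodic z).2 hz
  have hcont : ContinuousOn (fun z => ‖moebius (φ z) (φ (z + τ))‖) H := by
    have h1 : ContinuousOn (fun z => φ (z + τ)) H :=
      hφ.1.continuousOn.comp (by fun_prop) hHτ
    exact (hφ.1.continuousOn.moebius h1 hφ.2.mapsTo fun z hz => hφ.2.mapsTo (hHτ z hz)).norm
  have hlt : ∀ z ∈ H, ‖moebius (φ z) (φ (z + τ))‖ < 1 := fun z hz =>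
    norm_moebius_lt_one (mem_ball_zero_iff.1 (hφ.2.mapsTo hz))
      (mem_ball_zero_iff.1 (hφ.2.mapsTo (hHτ z hz)))
  set K : Set ℂ := closure 𝒯 ∩ (Icc m (R + 4 * Real.pi) ×ℂ Icc 0 (2 * Real.pi)) with hK
  have hKc : IsCompact K :=
    (isCompact_Icc.reProdIm isCompact_Icc).inter_left isClosed_closure
  have hKH : K ⊆ H := inter_subset_left.trans hdisj
  obtain ⟨s, hs, hsK⟩ : ∃ s < 1, ∀ z ∈ K, ‖moebius (φ z) (φ (z + τ))‖ ≤ s := by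
    rcases K.eq_empty_or_nonempty with h | h
    · exact ⟨0, one_pos, by simp [h]⟩
    · obtain ⟨x, hx, hmax⟩ := hKc.exists_isMaxOn h (hcont.mono hKH)
      exact ⟨_, hlt x (hKH hx), fun z hz => hmax hz⟩
  -- The `1 / 2` is `2π / 4π`: to the right of `R + 4π`, the disc of radius `4π` about `z` lies in
  -- `H`.
  refine ⟨max (1 / 2) s, max_lt (by norm_num) hs, fun z hz => ?_⟩
  have hπ := Real.pi_pos
  rcases le_or_gt z.re (R + 4 * Real.pi) with hre | hre
  · refine le_max_of_le_right ?_
    -- Translation by `k * τ` brings `z` into the compact piece `K`. Schwarz–Pick for the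
    -- translation back, a self-map of `H`, carries the bound from `K` to `z`.
    set k : ℤ := -⌊z.im / (2 * Real.pi)⌋ with hk
    have hkz : z + k * τ ∈ K := by
      refine ⟨subset_closure ((hF.periodic.add_mul_int_mem_iff z k).2 hz), ?_⟩
      have h1 := Int.floor_le (z.im / (2 * Real.pi))
      have h2 := Int.lt_floor_add_one (z.im / (2 * Real.pi))
      rw [le_div_iff₀ (by positivity)] at h1
      rw [div_lt_iff₀ (by positivity)] at h2
      rw [Complex.mem_reProdIm]
      simp only [Complex.add_re, Complex.add_im, Complex.mul_re, Complex.mul_im, Complex.intCast_re,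
        Complex.intCast_im, hτre, hτim, mem_Icc]
      have hkR : (k : ℝ) = -⌊z.im / (2 * Real.pi)⌋ := by rw [hk, Int.cast_neg]
      refine ⟨⟨?_, ?_⟩, ?_, ?_⟩
      · simpa using hm (mem_image_of_mem _ hz)
      · simpa using hre
      · rw [hkR]; linarith
      · rw [hkR]; linarith
    refine le_trans ?_ (hsK _ hkz)
    have htr : ∀ w ∈ H, w + -k * τ ∈ H := fun w hw => by
      have := (hF.H_periodic.add_mul_int_mem_iff w (-k)).2 hw
      rwa [Int.cast_neg] at this
    have h := hφ.norm_moebius_le hH (g := fun w => φ (w + -k * τ))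
      (hφ.1.comp (by fun_prop) htr) (fun w hw => hφ.2.mapsTo (htr w hw)) (hKH hkz)
      (hHτ _ (hKH hkz))
    rwa [show z + k * τ + -k * τ = z by ring, show z + k * τ + τ + -k * τ = z + τ by ring] at h
  · refine le_max_of_le_left ?_
    have hball : Metric.ball z (4 * Real.pi) ⊆ H := fun w hw => hR (by
      have h1 := (Complex.abs_re_le_norm (w - z)).trans_lt (mem_ball_iff_norm.1 hw)
      rw [Complex.sub_re, abs_lt] at h1
      rw [mem_ofPred_eq]
      linarith)
    have hdist : dist (z + τ) z = 2 * Real.pi := by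
      simp [hτ, abs_of_pos hπ]
    refine (norm_moebius_le_of_mapsTo_ball (hφ.1.mono hball) (hφ.2.mapsTo.mono_left hball)
      (z := z + τ) ?_).trans_eq ?_
    · rw [Metric.mem_ball, hdist]; linarith
    · rw [hdist]; field_simp; norm_num

theorem diskDeriv_comp {φ F : ℂ → ℂ} {z : ℂ} (hφ : DifferentiableAt ℂ φ (F z))
    (hF : DifferentiableAt ℂ F z) :
    diskDeriv (φ ∘ F) z = diskDeriv φ (F z) * ‖deriv F z‖ := by
  rw [diskDeriv, diskDeriv, deriv_comp z hφ hF, norm_mul, Function.comp_apply]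
  ring

/-- Working with the very map chosen in `hypDensity` avoids any need for independence of that
choice. -/
theorem exists_isConformalIso_hypDensity_eq {U : Set ℂ}
    (h : ∃ φ : ℂ → ℂ, IsConformalIso φ U (Metric.ball 0 1)) :
    ∃ φ : ℂ → ℂ, IsConformalIso φ U (Metric.ball 0 1) ∧
      ∀ z, hypDensity U z = 2 * diskDeriv φ z := by
  refine ⟨h.choose, h.choose_spec, fun z => ?_⟩
  rw [hypDensity, dif_pos h, discDensity, diskDeriv]
  ring

theorem IsClassBlog.exists_lt_mul_hypDensity_le {F : ℂ → ℂ} {𝒯 H : Set ℂ}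
    (hF : IsClassBlog F 𝒯 H) (hdisj : IsDisjointType 𝒯 H) :
    ∃ L : ℝ, 1 < L ∧
      ∀ z ∈ 𝒯, L * hypDensity H z ≤ hypDensity H (F z) * ‖deriv F z‖ := by
  have hH := hF.H_jordan.isOpen
  obtain ⟨φ, hφ, hρ⟩ := exists_isConformalIso_hypDensity_eq
    (exists_isConformalIso_ball hH hF.H_jordan.isSimplyConnected hF.H_jordan.ne_univ)
  obtain ⟨s₁, hs₁, hle⟩ := exists_norm_moebius_translate_le hF hdisj hφ
  -- The maximum only ensures `0 < s`, so that the gain is meaningful.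
  set s := max (1 / 2) s₁ with hs
  have hs1 : s < 1 := max_lt (by norm_num) hs₁
  have hs0 : 0 < s := lt_max_of_lt_left (by norm_num)
  refine ⟨(1 + s) / (2 * √s), one_lt_one_add_div_two_mul_sqrt hs0 hs1, fun z hz => ?_⟩
  set τ : ℂ := 2 * (Real.pi : ℂ) * Complex.I with hτ
  set T := connectedComponentIn 𝒯 z with hT
  have hTt : IsTract 𝒯 T := ⟨z, hz, rfl⟩
  have hzT : z ∈ T := mem_connectedComponentIn hz
  have hTH : T ⊆ H := (connectedComponentIn_subset 𝒯 z).trans (subset_closure.trans hdisj)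
  have hzτ : z + τ ∈ H := (hF.H_periodic z).2 (hTH hzT)
  have hTo := (hF.tract_jordan T hTt).isOpen
  have hiso := hF.tract_iso T hTt
  have hzτT : z + τ ∉ T := fun h =>
    (hF.tract_disjoint T hTt 1 one_ne_zero).le_bot ⟨h, z, hzT, by simp [hτ]⟩
  have hφz := mem_ball_zero_iff.1 (hφ.2.mapsTo (hTH hzT))
  have ha := mem_ball_zero_iff.1 (hφ.2.mapsTo hzτ)
  have homit : ∀ w ∈ T, φ w ≠ φ (z + τ) := fun w hw h =>
    hzτT (hφ.2.injOn (hTH hw) hzτ h ▸ hw)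
  obtain ⟨h, hhd, hhm, -, hD⟩ := exists_sq_eq_moebius_comp hTo
    (hF.tract_jordan T hTt).isSimplyConnected (hφ.1.mono hTH) (hφ.2.mapsTo.mono_left hTH) ha homit
  -- The comparison takes place on `T`, where `φ ∘ F` is a Riemann map and `h` merely a competitor.
  have hsp := (hφ.comp hiso).diskDeriv_le hTo hhd hhm hzT
  rw [hD z hzT, diskDeriv_comp (hφ.1.differentiableAt (hH.mem_nhds (hiso.2.mapsTo hzT)))
    (hiso.1.differentiableAt (hTo.mem_nhds hzT))] at hsp
  have hsymm : ‖moebius (φ (z + τ)) (φ z)‖ = ‖moebius (φ z) (φ (z + τ))‖ := by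
    rw [moebius, moebius, norm_div, norm_div, norm_sub_rev, ← Complex.norm_conj (1 - _)]
    simp [mul_comm]
  have hb := one_add_div_two_mul_sqrt_le
    (norm_pos_iff.2 (mt (moebius_eq_zero_iff ha hφz).1 (homit z hzT)))
    (hsymm.trans_le ((hle z hz).trans (le_max_right (1 / 2) s₁))) hs1.le
  have hpos := diskDeriv_pos_of_injOn hH hφ.1 hφ.2.mapsTo hφ.2.injOn (hTH hzT)
  rw [hρ, hρ]
  have := mul_le_mul_of_nonneg_left hb hpos.le
  linarith

/-! ### From the metric to the distance -/

theorem hypDensity_pos {U : Set ℂ} (hU : IsOpen U)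
    (h : ∃ φ : ℂ → ℂ, IsConformalIso φ U (Metric.ball 0 1)) {z : ℂ} (hz : z ∈ U) :
    0 < hypDensity U z := by
  obtain ⟨φ, hφ, hρ⟩ := exists_isConformalIso_hypDensity_eq h
  rw [hρ]
  exact mul_pos two_pos (diskDeriv_pos_of_injOn hU hφ.1 hφ.2.mapsTo hφ.2.injOn hz)

theorem continuousOn_hypDensity {U : Set ℂ} (hU : IsOpen U)
    (h : ∃ φ : ℂ → ℂ, IsConformalIso φ U (Metric.ball 0 1)) : ContinuousOn (hypDensity U) U := by
  obtain ⟨φ, hφ, hρ⟩ := exists_isConformalIso_hypDensity_eq h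
  rw [funext hρ]
  exact continuousOn_const.mul (((hφ.1.deriv hU).continuousOn.norm).div
    (continuousOn_const.sub (hφ.1.continuousOn.norm.pow 2))
    fun z hz => (one_sub_normSq_pos (mem_ball_zero_iff.1 (hφ.2.mapsTo hz))).ne')

/-- A non-integrable function has integral `0` by convention, so comparing lengths requires
integrability of the larger integrand. On each open piece, `deriv γ` agrees with a derivative
continuous up to the endpoints. -/
theorem IsPiecewiseSmooth.intervalIntegrable {γ : ℝ → ℂ} {U : Set ℂ} {ρ : ℂ → ℝ}
    (hγ : IsPiecewiseSmooth γ) (hm : MapsTo γ (Icc 0 1) U) (hρ : ContinuousOn ρ U) :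
    IntervalIntegrable (fun t => ρ (γ t) * ‖deriv γ t‖) MeasureTheory.volume 0 1 := by
  obtain ⟨hc, n, t, h0, h1, hmono, hsm⟩ := hγ
  rw [← h0, ← h1]
  refine IntervalIntegrable.trans_iterate fun i hi => ?_
  have hsub : Icc (t i) (t (i + 1)) ⊆ Icc 0 1 :=
    Icc_subset_Icc (h0 ▸ hmono (Nat.zero_le i)) (h1 ▸ hmono hi)
  rcases (hmono (Nat.le_succ i)).eq_or_lt with heq | hlt
  · rw [← Nat.succ_eq_add_one, ← heq]
  rw [intervalIntegrable_iff_integrableOn_Ioo_of_le hlt.le]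
  have hcont : ContinuousOn
      (fun x => ρ (γ x) * ‖derivWithin γ (Icc (t i) (t (i + 1))) x‖) (Icc (t i) (t (i + 1))) :=
    (hρ.comp (hc.mono hsub) (hm.mono_left hsub)).mul
      ((hsm i hi).continuousOn_derivWithin (uniqueDiffOn_Icc hlt) le_rfl).norm
  refine (hcont.integrableOn_Icc.mono_set Ioo_subset_Icc_self).congr_fun (fun x hx => ?_)
    measurableSet_Ioo
  simp only [derivWithin_of_mem_nhds (Icc_mem_nhds hx.1 hx.2)]

theorem IsPiecewiseSmooth.comp_differentiableOn {γ : ℝ → ℂ} {G : ℂ → ℂ} {U : Set ℂ}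
    (hγ : IsPiecewiseSmooth γ) (hm : MapsTo γ (Icc 0 1) U) (hU : IsOpen U)
    (hG : DifferentiableOn ℂ G U) : IsPiecewiseSmooth (G ∘ γ) := by
  obtain ⟨hc, n, t, h0, h1, hmono, hsm⟩ := hγ
  refine ⟨hG.continuousOn.comp hc hm, n, t, h0, h1, hmono, fun i hi => ?_⟩
  have hsub : Icc (t i) (t (i + 1)) ⊆ Icc 0 1 :=
    Icc_subset_Icc (h0 ▸ hmono (Nat.zero_le i)) (h1 ▸ hmono hi)
  exact ((hG.contDiffOn hU).restrict_scalars ℝ).comp (hsm i hi) (hm.mono_left hsub)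

/-- The inverse Riemann map transports a segment of the disc. Without such a curve the infimum
defining `hypDist` would be `sInf ∅ = 0`. -/
theorem exists_isPiecewiseSmooth_joining {U : Set ℂ}
    (h : ∃ φ : ℂ → ℂ, IsConformalIso φ U (Metric.ball 0 1)) (hU : IsOpen U) {z w : ℂ}
    (hz : z ∈ U) (hw : w ∈ U) :
    ∃ γ : ℝ → ℂ, IsPiecewiseSmooth γ ∧ MapsTo γ (Icc 0 1) U ∧ γ 0 = z ∧ γ 1 = w := by
  obtain ⟨φ, hφ⟩ := h
  obtain ⟨ψ, hψ, hl, -⟩ := hφ.exists_inverse hU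
  have hseg : MapsTo (AffineMap.lineMap (k := ℝ) (φ z) (φ w)) (Icc (0 : ℝ) 1)
      (Metric.ball 0 1) := fun t ht =>
    (convex_ball (0 : ℂ) 1).segment_subset (hφ.2.mapsTo hz) (hφ.2.mapsTo hw)
      (segment_eq_image_lineMap ℝ (φ z) (φ w) ▸ mem_image_of_mem _ ht)
  have hsm : IsPiecewiseSmooth (AffineMap.lineMap (k := ℝ) (φ z) (φ w)) := by
    refine ⟨AffineMap.lineMap_continuous.continuousOn, 1, fun i => if i = 0 then 0 else 1,
      by simp, by simp, fun i j hij => ?_, fun i _ => ?_⟩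
    · simp only
      split_ifs with h1 h2 <;> first | omega | norm_num
    · refine ContDiff.contDiffOn ?_
      have : ContDiff ℝ 1 fun t : ℝ => t • (φ w - φ z) + φ z := by fun_prop
      convert this using 2 with t
      simp [AffineMap.lineMap_apply]
  refine ⟨ψ ∘ AffineMap.lineMap (k := ℝ) (φ z) (φ w),
    hsm.comp_differentiableOn hseg Metric.isOpen_ball hψ.1, hψ.2.mapsTo.comp hseg, ?_, ?_⟩
  · simp [hl hz]
  · simp [hl hw]

/-- If `F : T → H` is a conformal isomorphism that expands the hyperbolic metric of `H ⊇ T`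
infinitesimally, then it expands the hyperbolic distance of `H`. -/
theorem IsConformalIso.mul_hypDist_le {F : ℂ → ℂ} {T H : Set ℂ} {L : ℝ} (hT : IsOpen T)
    (hH : IsOpen H) (h : ∃ φ : ℂ → ℂ, IsConformalIso φ H (Metric.ball 0 1)) (hTH : T ⊆ H)
    (hF : IsConformalIso F T H) (hL : 0 ≤ L)
    (hexp : ∀ z ∈ T, L * hypDensity H z ≤ hypDensity H (F z) * ‖deriv F z‖) {z₁ z₂ : ℂ}
    (h₁ : z₁ ∈ T) (h₂ : z₂ ∈ T) : L * hypDist H z₁ z₂ ≤ hypDist H (F z₁) (F z₂) := by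
  obtain ⟨G, hG, hl, hr⟩ := hF.exists_inverse hT
  have hpos : ∀ z ∈ H, 0 < hypDensity H z := fun z hz => hypDensity_pos hH h hz
  refine le_csInf ?_ ?_
  · obtain ⟨γ, hγ, hm, h0, h1⟩ :=
      exists_isPiecewiseSmooth_joining h hH (hF.2.mapsTo h₁) (hF.2.mapsTo h₂)
    exact ⟨_, γ, hγ, hm, h0, h1, rfl⟩
  -- A curve in `H` joining the images pulls back under the inverse branch `G` to a curve in `T`
  -- joining `z₁` to `z₂`, shorter by the factor `L`.
  rintro _ ⟨γ, hγ, hm, h0, h1, rfl⟩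
  have hGm : MapsTo (G ∘ γ) (Icc 0 1) T := hG.2.mapsTo.comp hm
  have hdist : hypDist H z₁ z₂ ≤ hypLength H (G ∘ γ) := by
    refine csInf_le ⟨0, ?_⟩ ⟨G ∘ γ, hγ.comp_differentiableOn hm hH hG.1, hGm.mono_right hTH,
      by simp [h0, hl h₁], by simp [h1, hl h₂], rfl⟩
    rintro _ ⟨δ, -, hδ, -, -, rfl⟩
    exact intervalIntegral.integral_nonneg zero_le_one fun t ht =>
      mul_nonneg (hpos _ (hδ ht)).le (norm_nonneg _)
  refine (mul_le_mul_of_nonneg_left hdist hL).trans ?_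
  have hint := hγ.intervalIntegrable hm (continuousOn_hypDensity hH h)
  rw [intervalIntegrable_iff_integrableOn_Ioo_of_le zero_le_one] at hint
  simp only [hypLength]
  rw [← intervalIntegral.integral_const_mul, intervalIntegral.integral_of_le zero_le_one,
    intervalIntegral.integral_of_le zero_le_one, MeasureTheory.integral_Ioc_eq_integral_Ioo,
    MeasureTheory.integral_Ioc_eq_integral_Ioo]
  refine MeasureTheory.integral_mono_of_nonneg ?_ hint ?_
  · refine (MeasureTheory.ae_restrict_iff' measurableSet_Ioo).2 (Eventually.of_forall fun t ht => ?_)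
    exact mul_nonneg hL (mul_nonneg (hpos _ (hTH (hGm (Ioo_subset_Icc_self ht)))).le
      (norm_nonneg _))
  refine (MeasureTheory.ae_restrict_iff' measurableSet_Ioo).2 (Eventually.of_forall fun t ht => ?_)
  have hT' := hGm (Ioo_subset_Icc_self ht)
  have hH' := hm (Ioo_subset_Icc_self ht)
  change L * (hypDensity H ((G ∘ γ) t) * ‖deriv (G ∘ γ) t‖) ≤ hypDensity H (γ t) * ‖deriv γ t‖
  -- Where `G ∘ γ` is not differentiable, its `deriv` is `0` by convention and the inequality is
  -- trivial, so the break points need no separate treatment.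
  by_cases hd : DifferentiableAt ℝ (G ∘ γ) t
  · have hγF : γ =ᶠ[𝓝 t] F ∘ (G ∘ γ) := by
      filter_upwards [Ioo_mem_nhds ht.1 ht.2] with x hx
      exact (hr (hm (Ioo_subset_Icc_self hx))).symm
    have hder : deriv γ t = deriv F ((G ∘ γ) t) * deriv (G ∘ γ) t := by
      rw [hγF.deriv_eq]
      exact ((hF.1.differentiableAt (hT.mem_nhds hT')).hasDerivAt.comp t hd.hasDerivAt).deriv
    rw [hder, norm_mul, ← mul_assoc, ← mul_assoc]
    refine mul_le_mul_of_nonneg_right ?_ (norm_nonneg _)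
    have := hexp _ hT'
    rwa [show F ((G ∘ γ) t) = γ t from hr hH'] at this
  · rw [deriv_zero_of_not_differentiableAt hd, norm_zero, mul_zero, mul_zero]
    exact mul_nonneg (hpos _ hH').le (norm_nonneg _)

theorem lemma6p3 (F : ℂ → ℂ) (𝒯 H : Set ℂ) (hF : IsClassBlog F 𝒯 H)
    (hdisj : IsDisjointType 𝒯 H) :
    ∃ L : ℝ, 1 < L ∧
      (∀ z ∈ 𝒯, L ≤ hypDeriv H F z) ∧
      (∀ T, IsTract 𝒯 T → ∀ z₁ ∈ T, ∀ z₂ ∈ T,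
        L * hypDist H z₁ z₂ ≤ hypDist H (F z₁) (F z₂)) := by
  have hH := hF.H_jordan.isOpen
  have hφ := exists_isConformalIso_ball hH hF.H_jordan.isSimplyConnected hF.H_jordan.ne_univ
  obtain ⟨L, hL, hexp⟩ := hF.exists_lt_mul_hypDensity_le hdisj
  have h𝒯 : 𝒯 ⊆ H := subset_closure.trans hdisj
  refine ⟨L, hL, fun z hz => ?_, fun T hT z₁ h₁ z₂ h₂ => ?_⟩
  · rw [hypDeriv, div_mul_eq_mul_div, le_div_iff₀ (hypDensity_pos hH hφ (h𝒯 hz))]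
    exact hexp z hz
  · have hT𝒯 : T ⊆ 𝒯 := by
      obtain ⟨z, -, rfl⟩ := hT
      exact connectedComponentIn_subset 𝒯 z
    exact (hF.tract_iso T hT).mul_hypDist_le (hF.tract_jordan T hT).isOpen hH hφ (hT𝒯.trans h𝒯)
      (zero_le_one.trans hL.le) (fun z hz => hexp z (hT𝒯 hz)) h₁ h₂
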